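/- For $n\ge 1$ put $k=\lfloor\sqrt n\rfloor$ (so $k=\sqrt n$ when $n$ is a perfect square). The partial function $\mathsf{MajIx}_n(x,I)$ takes as inputs $x\in\{0,1\}^n$ (held by Alice) and a set $I\subseteq\{1,\dots,n\}$ of exactly $k$ distinct indices (held by Bob). It is $1$ if $|\{i\in I: x_i=1\}|=k$, it is $0$ if $|\{i\in I: x_i=1\}|\le 0.9\,k$, and it is undefined otherwise. A one-way QCMA protocol with shared entanglement works as follows. Alice and Bob share an input-independent bipartite quantum state of arbitrary finite dimension. Merlin, who knows both inputs, sends Alice a classical proof $p\in\{0,1\}^a$. Depending on $x$ and $p$, Alice applies a quantum operation to her half of the shared state and sends the resulting $q$ qubits to Bob. Depending on $I$, Bob performs a two-outcome measurement on these qubits together with his half of the shared state, and accepts or rejects. The protocol computes $\mathsf{MajIx}_n$ if for every $1$-input there is a proof with which Bob accepts with probability at least $2/3$, and for every $0$-input and every proof Bob rejects with probability at least $2/3$. Its cost is $a+q$, and $QCMA^{A\to B,*}(\mathsf{MajIx}_n)$ is the minimum cost of a protocol computing $\mathsf{MajIx}_n$. **Theorem.** $QCMA^{A\to B,*}(\mathsf{MajIx}_n)\ge\Omega(\sqrt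 n/\log n)$: there are a constant $C>0$ and an $N$ such that for all $n\ge N$ every one-way QCMA protocol with shared entanglement that computes $\mathsf{MajIx}_n$ has cost at least $C\sqrt n/\log n$. -/

import Mathlib

open scoped ComplexOrder Kronecker

namespace QComm

/-- A quantum state on `ℂ^D`: a positive semidefinite matrix of trace `1`. -/
structure DensityMatrix (D : Type) [Fintype D] [DecidableEq D] where
  mat : Matrix D D ℂ
  posSemidef : mat.PosSemidef
  trace_eq_one : mat.trace = 1

/-- A quantum operation (completely positive trace preserving map) from states on `ℂ^D` to states
on `ℂ^E`, given by Kraus operators `K i` with `∑ i, (K i)ᴴ * K i = 1`. -/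
structure QuantumChannel (D E : Type) [Fintype D] [DecidableEq D] [Fintype E] [DecidableEq E] where
  numKraus : ℕ
  kraus : Fin numKraus → Matrix E D ℂ
  sum_kraus : ∑ i, (kraus i).conjTranspose * kraus i = 1

/-- Apply the channel to the first half of a bipartite matrix, `(Φ ⊗ id)(ρ)`. -/
noncomputable def QuantumChannel.applyLeft {D E B : Type} [Fintype D] [DecidableEq D]
    [Fintype E] [DecidableEq E] [Fintype B] [DecidableEq B] (Φ : QuantumChannel D E)
    (ρ : Matrix (D × B) (D × B) ℂ) : Matrix (E × B) (E × B) ℂ :=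
  ∑ i, (Φ.kraus i ⊗ₖ (1 : Matrix B B ℂ)) * ρ * (Φ.kraus i ⊗ₖ (1 : Matrix B B ℂ)).conjTranspose

/-- A two-outcome measurement `{acc, 1 - acc}`. -/
structure BinaryMeasurement (D : Type) [Fintype D] [DecidableEq D] where
  acc : Matrix D D ℂ
  acc_posSemidef : acc.PosSemidef
  rej_posSemidef : (1 - acc).PosSemidef

/-- Basis labels of a register of `q` qubits. -/
abbrev Qubits (q : ℕ) : Type := Fin q → Bool

/-- A one-way QCMA protocol with shared entanglement. Merlin sends a classical string of
`proofLen` bits to Alice. Alice, holding `x`, the proof and her half of the shared state, produces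
`msgLen` qubits by a quantum operation and sends them to Bob, who measures them together with
his half of the shared state; the measurement depends only on `y`. The two halves of the
input-independent shared state may have any finite dimension. -/
structure QCMAProtocol (X Y : Type) where
  proofLen : ℕ
  msgLen : ℕ
  dimA : ℕ
  dimB : ℕ
  shared : DensityMatrix (Fin dimA × Fin dimB)
  alice : X → (Fin proofLen → Bool) → QuantumChannel (Fin dimA) (Qubits msgLen)
  bob : Y → BinaryMeasurement (Qubits msgLen × Fin dimB)

namespace QCMAProtocol

variable {X Y : Type}

/-- Total communication: bits sent by Merlin plus qubits sent by Alice. -/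
def cost (P : QCMAProtocol X Y) : ℕ := P.proofLen + P.msgLen

/-- Probability that Bob accepts on input `(x, y)` when Merlin sends the proof `p`. -/
noncomputable def acceptProb (P : QCMAProtocol X Y) (x : X) (y : Y)
    (p : Fin P.proofLen → Bool) : ℝ :=
  (((P.bob y).acc * (P.alice x p).applyLeft P.shared.mat).trace).re

/-- Correctness for a partial function (`none` means undefined): every `1`-input has a proof
accepted with probability at least `2/3`; on a `0`-input every proof is rejected with probability
at least `2/3`. -/
def Computes (P : QCMAProtocol X Y) (f : X → Y → Option Bool) : Prop :=
  (∀ x y, f x y = some true → ∃ p, 2 / 3 ≤ P.acceptProb x y p) ∧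
  (∀ x y, f x y = some false → ∀ p, 2 / 3 ≤ 1 - P.acceptProb x y p)

end QCMAProtocol

/-- The entanglement-assisted one-way QCMA communication complexity: the least cost of a protocol
computing `f` (`⊤` if there is none). -/
noncomputable def qcmaComplexity {X Y : Type} (f : X → Y → Option Bool) : ℕ∞ :=
  ⨅ (P : QCMAProtocol X Y) (_ : P.Computes f), (P.cost : ℕ∞)

/-- Bob's inputs: sets of `⌊√n⌋` distinct indices. -/
abbrev IndexSet (n : ℕ) : Type := {I : Finset (Fin n) // I.card = Nat.sqrt n}

/-- The partial function MajIx: `1` if `x` is one on all of `I`, `0` if `x` is one on at most a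
`0.9` fraction of `I`, and undefined otherwise. -/
noncomputable def MajIx (n : ℕ) (x : Fin n → Bool) (I : IndexSet n) : Option Bool :=
  if (I.1.filter (fun i => x i = true)).card = Nat.sqrt n then some true
  else if ((I.1.filter (fun i => x i = true)).card : ℝ) ≤ 0.9 * (Nat.sqrt n : ℝ) then some false
  else none

end QComm

/-! A learning argument plays a cheap protocol against exponentially many inputs. A
Gilbert–Varshamov code (`exists_bitstrings`) gives strings of equal weight whose sets of ones
pairwise overlap in at most a quarter. For each codeword `x`, fix the proof accepted for the most
index sets inside its ones (`exists_popular_proof`). If the proof is short, these sets are so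
numerous that, for any other codeword, almost all of them are `0`-inputs.

No signalling keeps Bob's reduced state fixed, so every message of `q` qubits lies below one
operator of trace `4 ^ q` (`messageBound_sub_posSemidef`). Taking copies and a majority vote makes
the errors tiny and preserves the domination.

Every large candidate set has an index set that is positive for a noticeable fraction and negative
for almost all of it (`exists_positive_negative`). Test the dominating operator there and keep the
candidates predicting an outcome that shrinks its weight: acceptance, if unlikely, costs many
candidates but shrinks the weight greatly; rejection costs few candidates and shrinks it slightly
(`exists_tests`). A surviving candidate passes every test almost surely, so gentle measurement
leaves its message weight at least `1 / 4` (`le_weight_prod`). By domination the bounding operator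
keeps at least as much, which forces `q` to be large. -/

set_option linter.unusedSectionVars false

namespace QComm

open Matrix

/-! ### Effects and the weight left by measurements -/

section Effects

variable {H : Type*} [Fintype H] [DecidableEq H]

open scoped MatrixOrder in
theorem exists_conjTranspose_mul_self {A : Matrix H H ℂ} (hA : A.PosSemidef) :
    ∃ C : Matrix H H ℂ, A = Cᴴ * C := by
  have h0 : 0 ≤ A := nonneg_iff_posSemidef.mpr hA
  refine ⟨CFC.sqrt A, ?_⟩
  have h1 : 0 ≤ CFC.sqrt A := CFC.sqrt_nonneg A
  have h2 : (CFC.sqrt A)ᴴ = CFC.sqrt A := (nonneg_iff_posSemidef.mp h1).isHermitian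
  rw [h2, CFC.sqrt_mul_sqrt_self A h0]

theorem trace_mul_nonneg {A B : Matrix H H ℂ} (hA : A.PosSemidef) (hB : B.PosSemidef) :
    0 ≤ (A * B).trace := by
  obtain ⟨C, rfl⟩ := exists_conjTranspose_mul_self hB
  have : (A * (Cᴴ * C)).trace = (C * A * Cᴴ).trace := by
    rw [← Matrix.mul_assoc, Matrix.trace_mul_comm, Matrix.mul_assoc]
  rw [this]
  exact (hA.mul_mul_conjTranspose_same C).trace_nonneg

/-- A matrix `A` with `0 ≤ A ≤ 1`. -/
structure IsEffect (A : Matrix H H ℂ) : Prop where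
  posSemidef : A.PosSemidef
  compl_posSemidef : (1 - A).PosSemidef

theorem IsEffect.compl {A : Matrix H H ℂ} (hA : IsEffect A) : IsEffect (1 - A) :=
  ⟨hA.2, by simpa using hA.1⟩

theorem IsEffect.sub_sq_posSemidef {A : Matrix H H ℂ} (hA : IsEffect A) :
    (A - A * A).PosSemidef := by
  have h1 := hA.2.mul_mul_conjTranspose_same A
  have h2 := hA.1.mul_mul_conjTranspose_same (1 - A)
  rw [hA.1.isHermitian.eq] at h1
  rw [hA.2.isHermitian.eq] at h2
  -- `A - A² = A (1 - A) A + (1 - A) A (1 - A)`.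
  convert h1.add h2 using 1
  noncomm_ring

/-- The weight `tr (V σ V*)` left after applying the operator `V` to `σ`. -/
noncomputable def weight (σ V : Matrix H H ℂ) : ℝ := (V * σ * Vᴴ).trace.re

theorem weight_one (σ : Matrix H H ℂ) : weight σ 1 = σ.trace.re := by simp [weight]

theorem weight_mono {ρ σ : Matrix H H ℂ} (h : (σ - ρ).PosSemidef) (V : Matrix H H ℂ) :
    weight ρ V ≤ weight σ V := by
  have h1 := (Complex.le_def.mp (h.mul_mul_conjTranspose_same V).trace_nonneg).1
  rw [Matrix.mul_sub, Matrix.sub_mul, Matrix.trace_sub] at h1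
  simp only [Complex.zero_re, Complex.sub_re] at h1
  unfold weight
  linarith

theorem weight_nonneg {σ : Matrix H H ℂ} (h : σ.PosSemidef) (V : Matrix H H ℂ) :
    0 ≤ weight σ V :=
  (Complex.le_def.mp (h.mul_mul_conjTranspose_same V).trace_nonneg).1

theorem weight_mul_of_isHermitian {A : Matrix H H ℂ} (hA : A.IsHermitian) (σ V : Matrix H H ℂ) :
    weight σ (A * V) = (A * A * (V * σ * Vᴴ)).trace.re := by
  unfold weight
  rw [Matrix.conjTranspose_mul, hA.eq, Matrix.mul_assoc A A, Matrix.trace_mul_comm A]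
  simp only [Matrix.mul_assoc]

/-- A two-outcome measurement does not increase the total weight. -/
theorem weight_split {σ A : Matrix H H ℂ} (hσ : σ.PosSemidef) (hA : IsEffect A)
    (V : Matrix H H ℂ) :
    weight σ (A * V) + weight σ ((1 - A) * V) ≤ weight σ V := by
  have hS := hσ.mul_mul_conjTranspose_same V
  have h1 := (Complex.le_def.mp (trace_mul_nonneg (hA.sub_sq_posSemidef.add hA.sub_sq_posSemidef)
    hS)).1
  rw [weight_mul_of_isHermitian hA.1.isHermitian, weight_mul_of_isHermitian hA.2.isHermitian]
  -- `A² + (1 - A)² = 1 - 2 (A - A²)`, which is at most `1`.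
  have h2 : A * A * (V * σ * Vᴴ) + (1 - A) * (1 - A) * (V * σ * Vᴴ)
      = V * σ * Vᴴ - (A - A * A + (A - A * A)) * (V * σ * Vᴴ) := by
    noncomm_ring
  rw [← Complex.add_re, ← Matrix.trace_add, h2, Matrix.trace_sub, Complex.sub_re]
  simp only [Complex.zero_re] at h1
  unfold weight
  linarith

end Effects

/-! ### Gentle sequential measurement -/

section Gentle

variable {H : Type*} [Fintype H] [DecidableEq H]

attribute [local instance] Matrix.frobeniusNormedAddCommGroup

theorem frobenius_norm_sq (Y : Matrix H H ℂ) : ‖Y‖ ^ 2 = (Y * Yᴴ).trace.re := by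
  have h0 : 0 ≤ ∑ i, ∑ j, ‖Y i j‖ ^ (2 : ℝ) := by positivity
  rw [frobenius_norm_def, ← Real.sqrt_eq_rpow, Real.sq_sqrt h0]
  simp only [Matrix.trace, Matrix.diag_apply, Matrix.mul_apply, Complex.re_sum,
    Matrix.conjTranspose_apply]
  refine Finset.sum_congr rfl fun i _ => Finset.sum_congr rfl fun j _ => ?_
  rw [Real.rpow_two, ← Complex.normSq_eq_norm_sq, Complex.star_def, Complex.mul_conj,
    Complex.ofReal_re]

/-- Turns weights into squared Frobenius norms, so that the triangle inequality applies to
successive measurements. -/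
theorem weight_conjTranspose_mul_self (C V : Matrix H H ℂ) :
    weight (Cᴴ * C) V = ‖V * Cᴴ‖ ^ 2 := by
  rw [frobenius_norm_sq, weight, Matrix.conjTranspose_mul, Matrix.conjTranspose_conjTranspose]
  simp only [Matrix.mul_assoc]

theorem IsEffect.norm_mul_le {A : Matrix H H ℂ} (hA : IsEffect A) (Y : Matrix H H ℂ) :
    ‖A * Y‖ ≤ ‖Y‖ := by
  refine le_of_sq_le_sq ?_ (norm_nonneg _)
  have h1 := weight_split (σ := 1) (Matrix.PosSemidef.one) hA Y
  have h2 := weight_nonneg (σ := (1 : Matrix H H ℂ)) Matrix.PosSemidef.one ((1 - A) * Y)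
  have h3 : ∀ Z : Matrix H H ℂ, weight (1 : Matrix H H ℂ) Z = ‖Z‖ ^ 2 := by
    intro Z
    simp [frobenius_norm_sq, weight]
  simp only [h3] at h1 h2
  linarith

/-- Because `(1 - B)² ≤ 1 - B`, a small failure probability means a small disturbance. -/
theorem IsEffect.norm_one_sub_mul_sq_le {B C : Matrix H H ℂ} (hB : IsEffect B) :
    ‖(1 - B) * Cᴴ‖ ^ 2 ≤ ((1 - B) * (Cᴴ * C)).trace.re := by
  have h1 := (Complex.le_def.mp (trace_mul_nonneg hB.compl.sub_sq_posSemidef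
    (posSemidef_conjTranspose_mul_self C))).1
  rw [← weight_conjTranspose_mul_self]
  have h2 := weight_mul_of_isHermitian hB.2.isHermitian (Cᴴ * C) 1
  simp only [Matrix.mul_one, Matrix.one_mul, Matrix.conjTranspose_one] at h2
  rw [h2]
  rw [Matrix.sub_mul, Matrix.trace_sub, Complex.sub_re] at h1
  simp only [Complex.zero_re] at h1
  linarith

theorem norm_sub_prod_mul_le {C : Matrix H H ℂ} {ε : ℝ} (Bs : List (Matrix H H ℂ))
    (hB : ∀ B ∈ Bs, IsEffect B) (hε : ∀ B ∈ Bs, ((1 - B) * (Cᴴ * C)).trace.re ≤ ε) :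
    ‖Cᴴ - Bs.prod * Cᴴ‖ ≤ Bs.length * √ε := by
  induction Bs with
  | nil => simp
  | cons B Bs ih =>
    have ih := ih (fun B hB' => hB B (by simp [hB'])) (fun B hB' => hε B (by simp [hB']))
    have hB0 := hB B (by simp)
    -- Telescoping: one new disturbance plus the old error, which the contraction `B` does not
    -- enlarge.
    have h1 : Cᴴ - (B :: Bs).prod * Cᴴ = (1 - B) * Cᴴ + B * (Cᴴ - Bs.prod * Cᴴ) := by
      rw [List.prod_cons]
      noncomm_ring
    have h2 : ‖(1 - B) * Cᴴ‖ ≤ √ε :=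
      Real.le_sqrt_of_sq_le (hB0.norm_one_sub_mul_sq_le.trans (hε B (by simp)))
    calc ‖Cᴴ - (B :: Bs).prod * Cᴴ‖ ≤ ‖(1 - B) * Cᴴ‖ + ‖B * (Cᴴ - Bs.prod * Cᴴ)‖ := by
          rw [h1]; exact norm_add_le _ _
      _ ≤ √ε + Bs.length * √ε := add_le_add h2 ((hB0.norm_mul_le _).trans ih)
      _ = _ := by simp; ring

/-- Gentle sequential measurement: effects that each hold with probability at least `1 - ε` keep
a constant part of the state when they are applied one after the other. -/
theorem le_weight_prod {ρ : Matrix H H ℂ} (hρ : ρ.PosSemidef) (htr : ρ.trace = 1) {ε : ℝ}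
    (Bs : List (Matrix H H ℂ)) (hB : ∀ B ∈ Bs, IsEffect B)
    (hε : ∀ B ∈ Bs, ((1 - B) * ρ).trace.re ≤ ε) (hlen : Bs.length * √ε ≤ 1 / 2) :
    1 / 4 ≤ weight ρ Bs.prod := by
  obtain ⟨C, rfl⟩ := exists_conjTranspose_mul_self hρ
  have h1 := norm_sub_prod_mul_le Bs hB hε
  have h2 : ‖Cᴴ‖ = 1 := by
    have h := weight_conjTranspose_mul_self C 1
    rw [weight_one, htr, Matrix.one_mul] at h
    have h0 := norm_nonneg Cᴴ
    simp only [Complex.one_re] at h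
    nlinarith
  have h3 : ‖Cᴴ‖ ≤ ‖Cᴴ - Bs.prod * Cᴴ‖ + ‖Bs.prod * Cᴴ‖ := by
    simpa using norm_add_le (Cᴴ - Bs.prod * Cᴴ) (Bs.prod * Cᴴ)
  rw [weight_conjTranspose_mul_self]
  have h4 : 1 / 2 ≤ ‖Bs.prod * Cᴴ‖ := by linarith
  nlinarith

end Gentle

/-! ### Learning by elimination of candidates -/

section Learning

variable {H : Type*} [Fintype H] [DecidableEq H]

open Classical in
/-- If among every large set of candidates some test is positive for a noticeable fraction and
negative for almost all of them, then some candidate passes a short sequence of tests that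
reduces the weight of `σ` below `R`. -/
theorem exists_tests {X ι : Type*} (A : ι → Matrix H H ℂ) (hA : ∀ i, IsEffect (A i))
    {σ : Matrix H H ℂ} (hσ : σ.PosSemidef) (Pos Neg : X → ι → Prop) {M N γ L R : ℝ}
    (hM : 0 < M) (hN : 1 ≤ N) (hγ : 0 < γ) (hγ1 : γ ≤ 1) (hL : 1 ≤ L)
    (step : ∀ S : Finset X, M ≤ S.card → ∃ i, (S.card : ℝ) ≤ N * (S.filter (Pos · i)).card ∧
      γ * S.card ≤ (S.filter (Neg · i)).card) (t : ℕ) :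
    ∀ (m : ℕ) (S : Finset X) (V : Matrix H H ℂ), M * N ^ t ≤ γ ^ m * S.card →
      weight σ V / L ^ t ≤ R → weight σ V * (1 - 1 / L) ^ m ≤ R →
      ∃ x ∈ S, ∃ Bs : List (Matrix H H ℂ), Bs.length ≤ t + m ∧
        (∀ B ∈ Bs, ∃ i, (B = A i ∧ Pos x i) ∨ (B = 1 - A i ∧ Neg x i)) ∧
        weight σ (Bs.prod * V) ≤ R := by
  have hL0 : 0 < L := by linarith
  have hδ0 : 0 ≤ 1 - 1 / L := by
    have : 1 / L ≤ 1 := by rw [div_le_one hL0]; exact hL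
    linarith
  have hδ1 : 1 - 1 / L ≤ 1 := by
    have : 0 ≤ 1 / L := by positivity
    linarith
  have large : ∀ (t m : ℕ) (S : Finset X), M * N ^ t ≤ γ ^ m * S.card → M ≤ S.card := by
    intro t m S h
    have h1 : (1 : ℝ) ≤ N ^ t := one_le_pow₀ hN
    have h2 : γ ^ m ≤ 1 := pow_le_one₀ hγ.le hγ1
    have h3 : γ ^ m * S.card ≤ S.card := mul_le_of_le_one_left (by positivity) h2
    nlinarith
  have base : ∀ (t m : ℕ) (S : Finset X) (V : Matrix H H ℂ), M * N ^ t ≤ γ ^ m * S.card →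
      weight σ V ≤ R → ∃ x ∈ S, ∃ Bs : List (Matrix H H ℂ), Bs.length ≤ t + m ∧
        (∀ B ∈ Bs, ∃ i, (B = A i ∧ Pos x i) ∨ (B = 1 - A i ∧ Neg x i)) ∧
        weight σ (Bs.prod * V) ≤ R := by
    intro t m S V h hR
    have h1 : (0 : ℝ) < S.card := hM.trans_le (large t m S h)
    obtain ⟨x, hx⟩ := Finset.card_pos.mp (by exact_mod_cast h1)
    exact ⟨x, hx, [], by simp, by simp, by simpa using hR⟩
  induction t with
  | zero =>
    intro m S V h h1 _
    exact base 0 m S V h (by simpa using h1)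
  | succ t iht =>
    intro m
    induction m with
    | zero =>
      intro S V h _ h1
      exact base (t + 1) 0 S V h (by simpa using h1)
    | succ m ihm =>
      intro S V h h1 h2
      obtain ⟨i, hi1, hi2⟩ := step S (large _ _ S h)
      have hsplit := weight_split hσ (hA i) V
      -- If acceptance is unlikely, keep the positive candidates and spend one unit of `t`.
      -- Otherwise rejection loses a factor `1 - 1 / L`; keep the negative ones and spend one unit
      -- of `m`.
      by_cases hacc : weight σ (A i * V) ≤ weight σ V / L
      · have hw : weight σ (A i * V) ≤ weight σ V :=
          hacc.trans (div_le_self (weight_nonneg hσ V) hL)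
        obtain ⟨x, hx, Bs, hlen, hBs, hR⟩ := iht (m + 1) (S.filter (Pos · i)) (A i * V)
          (by
            have h3 : γ ^ (m + 1) * (S.card : ℝ)
                ≤ γ ^ (m + 1) * (N * (S.filter (Pos · i)).card) :=
              mul_le_mul_of_nonneg_left hi1 (by positivity)
            have h4 : N * (M * N ^ t) ≤ N * (γ ^ (m + 1) * (S.filter (Pos · i)).card) := by
              calc N * (M * N ^ t) = M * N ^ (t + 1) := by ring
                _ ≤ _ := h.trans h3
                _ = _ := by ring
            exact le_of_mul_le_mul_left h4 (by linarith))
          (by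
            refine le_trans ?_ h1
            calc weight σ (A i * V) / L ^ t ≤ weight σ V / L / L ^ t := by gcongr
              _ = weight σ V / L ^ (t + 1) := by rw [div_div, pow_succ']; )
          ((mul_le_mul_of_nonneg_right hw (by positivity)).trans h2)
        obtain ⟨hxS, hxP⟩ := Finset.mem_filter.mp hx
        refine ⟨x, hxS, Bs ++ [A i], by simp; omega, ?_, ?_⟩
        · intro B hB
          rcases List.mem_append.mp hB with hB | hB
          · exact hBs B hB
          · exact ⟨i, Or.inl ⟨by simpa using hB, hxP⟩⟩
        · simpa [Matrix.mul_assoc] using hR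
      · have hrej : weight σ ((1 - A i) * V) ≤ weight σ V * (1 - 1 / L) := by
          rw [mul_sub, mul_one, mul_one_div]
          linarith
        have hw : weight σ ((1 - A i) * V) ≤ weight σ V :=
          hrej.trans (mul_le_of_le_one_right (weight_nonneg hσ V) hδ1)
        obtain ⟨x, hx, Bs, hlen, hBs, hR⟩ := ihm (S.filter (Neg · i)) ((1 - A i) * V)
          (by
            calc M * N ^ (t + 1) ≤ γ ^ (m + 1) * S.card := h
              _ = γ ^ m * (γ * S.card) := by ring
              _ ≤ _ := mul_le_mul_of_nonneg_left hi2 (by positivity))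
          (le_trans (by gcongr) h1)
          (by
            refine le_trans ?_ h2
            calc weight σ ((1 - A i) * V) * (1 - 1 / L) ^ m
                ≤ weight σ V * (1 - 1 / L) * (1 - 1 / L) ^ m :=
                  mul_le_mul_of_nonneg_right hrej (by positivity)
              _ = _ := by ring)
        obtain ⟨hxS, hxN⟩ := Finset.mem_filter.mp hx
        refine ⟨x, hxS, Bs ++ [1 - A i], by simp; omega, ?_, ?_⟩
        · intro B hB
          rcases List.mem_append.mp hB with hB | hB
          · exact hBs B hB
          · exact ⟨i, Or.inr ⟨by simpa using hB, hxN⟩⟩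
        · simpa [Matrix.mul_assoc] using hR

end Learning

/-! ### Tensor powers and majority amplification -/

section TensorPower

variable {H : Type*} [Fintype H] [DecidableEq H] {r : ℕ}

/-- The tensor product of a family of matrices. -/
def piKron (M : Fin r → Matrix H H ℂ) : Matrix (Fin r → H) (Fin r → H) ℂ :=
  Matrix.of fun f g => ∏ i, M i (f i) (g i)

theorem piKron_mul (M N : Fin r → Matrix H H ℂ) :
    piKron M * piKron N = piKron (fun i => M i * N i) := by
  ext f g
  simp only [piKron, Matrix.mul_apply, Matrix.of_apply, ← Finset.prod_mul_distrib]
  exact (Fintype.prod_sum fun i j => M i (f i) j * N i j (g i)).symm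

theorem piKron_conjTranspose (M : Fin r → Matrix H H ℂ) :
    (piKron M)ᴴ = piKron (fun i => (M i)ᴴ) := by
  ext f g
  simp [piKron]

theorem trace_piKron (M : Fin r → Matrix H H ℂ) : (piKron M).trace = ∏ i, (M i).trace := by
  simp only [Matrix.trace, Matrix.diag_apply, piKron, Matrix.of_apply]
  exact (Fintype.prod_sum fun i j => M i j j).symm

theorem piKron_one : piKron (fun _ : Fin r => (1 : Matrix H H ℂ)) = 1 := by
  ext f g
  simp only [piKron, Matrix.of_apply, Matrix.one_apply, Finset.prod_ite_zero, Finset.prod_const_one,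
    funext_iff, Finset.mem_univ, true_imp_iff]

theorem piKron_posSemidef {M : Fin r → Matrix H H ℂ} (hM : ∀ i, (M i).PosSemidef) :
    (piKron M).PosSemidef := by
  choose C hC using fun i => exists_conjTranspose_mul_self (hM i)
  have : piKron M = (piKron C)ᴴ * piKron C := by
    rw [piKron_conjTranspose, piKron_mul]
    exact congrArg _ (funext hC)
  rw [this]
  exact posSemidef_conjTranspose_mul_self _

theorem piKron_add (M N : Fin r → Matrix H H ℂ) :
    piKron (fun i => M i + N i) = ∑ s : Finset (Fin r), piKron (s.piecewise M N) := by
  ext f g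
  rw [Matrix.sum_apply]
  simp only [piKron, Matrix.of_apply, Matrix.add_apply]
  rw [Fintype.prod_add]
  refine Finset.sum_congr rfl fun s _ => ?_
  rw [← Finset.prod_mul_prod_compl s]
  congr 1
  · exact Finset.prod_congr rfl fun i hi => by rw [Finset.piecewise_eq_of_mem _ _ _ hi]
  · exact Finset.prod_congr rfl fun i hi => by
      rw [Finset.piecewise_eq_of_notMem _ _ _ (Finset.mem_compl.mp hi)]

theorem piKron_piecewise_posSemidef {M N : Matrix H H ℂ} (hM : M.PosSemidef) (hN : N.PosSemidef)
    (s : Finset (Fin r)) : (piKron (s.piecewise (fun _ => M) fun _ => N)).PosSemidef := by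
  refine piKron_posSemidef fun i => ?_
  by_cases hi : i ∈ s
  · simpa [hi] using hM
  · simpa [hi] using hN

/-- Expanding the tensor power of `σ = ρ + (σ - ρ)` gives positive terms, one of which is the tensor
power of `ρ`. -/
theorem piKron_const_sub_posSemidef {ρ σ : Matrix H H ℂ} (hρ : ρ.PosSemidef)
    (h : (σ - ρ).PosSemidef) :
    (piKron (fun _ : Fin r => σ) - piKron (fun _ : Fin r => ρ)).PosSemidef := by
  have h1 : piKron (fun _ : Fin r => σ)
      = ∑ s : Finset (Fin r), piKron (s.piecewise (fun _ => ρ) (fun _ => σ - ρ)) := by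
    rw [← piKron_add]
    simp
  rw [h1, ← Finset.sum_erase_add _ _ (Finset.mem_univ Finset.univ)]
  simp only [Finset.piecewise_univ, add_sub_cancel_right]
  exact posSemidef_sum _ fun s _ => piKron_piecewise_posSemidef hρ h s

/-- The effect on `2 * w` copies that accepts when `A` accepts on more than `w` of them. -/
def majority (w : ℕ) (A : Matrix H H ℂ) : Matrix (Fin (2 * w) → H) (Fin (2 * w) → H) ℂ :=
  ∑ s : Finset (Fin (2 * w)) with w < s.card, piKron (s.piecewise (fun _ => A) fun _ => 1 - A)

theorem one_sub_majority (w : ℕ) (A : Matrix H H ℂ) : 1 - majority w A =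
    ∑ s : Finset (Fin (2 * w)) with ¬ w < s.card,
      piKron (s.piecewise (fun _ => A) fun _ => 1 - A) := by
  have h1 := piKron_add (fun _ : Fin (2 * w) => A) (fun _ => 1 - A)
  simp only [add_sub_cancel, piKron_one] at h1
  rw [h1, majority, ← Finset.sum_filter_add_sum_filter_not Finset.univ
    (fun s : Finset (Fin (2 * w)) => w < s.card), add_sub_cancel_left]

theorem IsEffect.majority {A : Matrix H H ℂ} (hA : IsEffect A) (w : ℕ) :
    IsEffect (majority w A) := by
  refine ⟨posSemidef_sum _ fun s _ => piKron_piecewise_posSemidef hA.1 hA.2 s, ?_⟩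
  rw [one_sub_majority]
  exact posSemidef_sum _ fun s _ => piKron_piecewise_posSemidef hA.1 hA.2 s

theorem trace_piKron_piecewise_mul {A ρ : Matrix H H ℂ} {p : ℝ} (hp : (A * ρ).trace = p)
    (htr : ρ.trace = 1) (s : Finset (Fin r)) :
    (piKron (s.piecewise (fun _ => A) fun _ => 1 - A) * piKron (fun _ => ρ)).trace.re
      = p ^ s.card * (1 - p) ^ (r - s.card) := by
  have hp' : ((1 - A) * ρ).trace = ((1 - p : ℝ) : ℂ) := by
    rw [Matrix.sub_mul, Matrix.trace_sub, Matrix.one_mul, htr, hp]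
    push_cast
    rfl
  have h : ∀ i, (s.piecewise (fun _ => A) (fun _ => 1 - A) i * ρ).trace
      = s.piecewise (fun _ => (p : ℂ)) (fun _ => ((1 - p : ℝ) : ℂ)) i := by
    intro i
    by_cases hi : i ∈ s
    · simp [hi, hp]
    · simp only [hi, not_false_eq_true, Finset.piecewise_eq_of_notMem, hp']
  rw [piKron_mul, trace_piKron, Finset.prod_congr rfl fun i _ => h i, Finset.prod_piecewise]
  simp only [Finset.prod_const, Finset.univ_inter, ← Finset.compl_eq_univ_sdiff,
    Finset.card_compl, Fintype.card_fin]
  rw [← Complex.ofReal_pow, ← Complex.ofReal_pow, ← Complex.ofReal_mul, Complex.ofReal_re]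

/-- A wrong majority has at least `w` wrong votes; the extreme case is a tie, with probability `(x *
y) ^ w` per pattern. -/
theorem pow_mul_pow_le {x y : ℝ} (hy : 0 ≤ y) (hyx : y ≤ x) (hxy : x * y ≤ 2 / 9)
    {w s : ℕ} (hs : s ≤ w) : x ^ s * y ^ (2 * w - s) ≤ (2 / 9) ^ w := by
  have hx : 0 ≤ x := hy.trans hyx
  calc x ^ s * y ^ (2 * w - s) = x ^ s * y ^ (w - s) * y ^ w := by
        rw [mul_assoc, ← pow_add]; congr 2; omega
    _ ≤ x ^ s * x ^ (w - s) * y ^ w := by gcongr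
    _ = (x * y) ^ w := by rw [← pow_add, mul_pow]; congr 2; omega
    _ ≤ _ := pow_le_pow_left₀ (mul_nonneg hx hy) hxy w

theorem sum_le_of_le_two_ninths (w : ℕ) (F : Finset (Finset (Fin (2 * w))))
    (f : Finset (Fin (2 * w)) → ℝ) (hf : ∀ s ∈ F, f s ≤ (2 / 9) ^ w) :
    ∑ s ∈ F, f s ≤ (8 / 9) ^ w := by
  -- Union bound over all `4 ^ w` outcome patterns.
  have hcard : (F.card : ℝ) ≤ 4 ^ w := by
    have h1 : F.card ≤ 2 ^ (2 * w) := by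
      simpa using Finset.card_le_univ F
    calc (F.card : ℝ) ≤ ((2 ^ (2 * w) : ℕ) : ℝ) := by exact_mod_cast h1
      _ = 4 ^ w := by rw [pow_mul]; norm_num
  calc ∑ s ∈ F, f s ≤ F.card * (2 / 9 : ℝ) ^ w := by
        rw [← nsmul_eq_mul]; exact Finset.sum_le_card_nsmul _ _ _ hf
    _ ≤ 4 ^ w * (2 / 9 : ℝ) ^ w := by gcongr
    _ = (8 / 9) ^ w := by rw [← mul_pow]; norm_num

theorem IsEffect.trace_mul_eq_ofReal {A ρ : Matrix H H ℂ} (hA : IsEffect A) (hρ : ρ.PosSemidef)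
    (htr : ρ.trace = 1) :
    (A * ρ).trace = ((A * ρ).trace.re : ℝ) ∧ 0 ≤ (A * ρ).trace.re ∧ (A * ρ).trace.re ≤ 1 := by
  have h1 := Complex.le_def.mp (trace_mul_nonneg hA.1 hρ)
  have h2 := Complex.le_def.mp (trace_mul_nonneg hA.2 hρ)
  rw [Matrix.sub_mul, Matrix.trace_sub, Matrix.one_mul, htr] at h2
  refine ⟨Complex.ext (by simp) (by simpa using h1.2.symm), h1.1, ?_⟩
  simpa using h2.1

theorem one_sub_majority_le {A ρ : Matrix H H ℂ} (hA : IsEffect A) (hρ : ρ.PosSemidef)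
    (htr : ρ.trace = 1) (w : ℕ) (h : 2 / 3 ≤ (A * ρ).trace.re) :
    ((1 - majority w A) * piKron (fun _ => ρ)).trace.re ≤ (8 / 9) ^ w := by
  obtain ⟨hp, hp0, hp1⟩ := hA.trace_mul_eq_ofReal hρ htr
  rw [one_sub_majority, Finset.sum_mul, Matrix.trace_sum, Complex.re_sum]
  refine sum_le_of_le_two_ninths w _ _ fun s hs => ?_
  rw [trace_piKron_piecewise_mul hp htr]
  exact pow_mul_pow_le (by linarith) (by linarith) (by nlinarith)
    (not_lt.mp (Finset.mem_filter.mp hs).2)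

theorem majority_le {A ρ : Matrix H H ℂ} (hA : IsEffect A) (hρ : ρ.PosSemidef)
    (htr : ρ.trace = 1) (w : ℕ) (h : 2 / 3 ≤ 1 - (A * ρ).trace.re) :
    (majority w A * piKron (fun _ => ρ)).trace.re ≤ (8 / 9) ^ w := by
  obtain ⟨hp, hp0, hp1⟩ := hA.trace_mul_eq_ofReal hρ htr
  rw [majority, Finset.sum_mul, Matrix.trace_sum, Complex.re_sum]
  refine sum_le_of_le_two_ninths w _ _ fun s hs => ?_
  have hs' := (Finset.mem_filter.mp hs).2
  have hc : s.card ≤ 2 * w := by simpa using Finset.card_le_univ s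
  rw [trace_piKron_piecewise_mul hp htr, mul_comm]
  have := pow_mul_pow_le (x := 1 - (A * ρ).trace.re) (y := (A * ρ).trace.re) (w := w)
    (s := 2 * w - s.card) hp0 (by linarith) (by nlinarith) (by omega)
  rwa [Nat.sub_sub_self hc] at this

end TensorPower

/-! ### Partial trace, domination and no signalling -/

section PartialTrace

variable {D E B : Type} [Fintype D] [DecidableEq D] [Fintype E] [DecidableEq E]
  [Fintype B] [DecidableEq B]

/-- The reduced matrix of a bipartite matrix on the second factor. -/
def traceLeft (ρ : Matrix (E × B) (E × B) ℂ) : Matrix B B ℂ :=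
  Matrix.of fun b b' => ∑ e, ρ (e, b) (e, b')

theorem trace_traceLeft (ρ : Matrix (E × B) (E × B) ℂ) : (traceLeft ρ).trace = ρ.trace := by
  simp only [Matrix.trace, Matrix.diag_apply, traceLeft, Matrix.of_apply, Fintype.sum_prod_type]
  exact Finset.sum_comm

/-- The operator `|e⟩⟨e'| ⊗ 1`. -/
def leftUnit (B : Type) [DecidableEq B] (e e' : E) : Matrix (E × B) (E × B) ℂ :=
  Matrix.single e e' 1 ⊗ₖ (1 : Matrix B B ℂ)

theorem sum_leftUnit : ∑ e : E, leftUnit B e e = 1 := by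
  ext ⟨i, b⟩ ⟨j, b'⟩
  by_cases h : i = j
  · subst h
    simp [leftUnit, Matrix.sum_apply, Matrix.single_apply, Matrix.one_apply]
  · have : ∀ e, ¬ (e = i ∧ e = j) := fun e he => h (he.1 ▸ he.2)
    simp [leftUnit, Matrix.sum_apply, Matrix.one_apply, h, this]

theorem leftUnit_isHermitian (e : E) : (leftUnit B e e)ᴴ = leftUnit B e e := by
  simp [leftUnit, Matrix.conjTranspose_kronecker]

theorem leftUnit_mul_mul (ρ : Matrix (E × B) (E × B) ℂ) (e e' i j : E) (b b' : B) :
    (leftUnit B e e' * ρ * (leftUnit B e e')ᴴ) (i, b) (j, b')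
      = if e = i ∧ e = j then ρ (e', b) (e', b') else 0 := by
  simp only [Matrix.mul_apply, leftUnit, Matrix.conjTranspose_apply, Matrix.kronecker_apply,
    Matrix.single_apply, Matrix.one_apply, Fintype.sum_prod_type, ite_and]
  by_cases h : e = i <;> by_cases h' : e = j <;> simp only [h, h'] <;>
    simp [apply_ite (starRingEnd ℂ)]

theorem one_kronecker_traceLeft (ρ : Matrix (E × B) (E × B) ℂ) :
    (1 : Matrix E E ℂ) ⊗ₖ traceLeft ρ
      = ∑ e, ∑ e', leftUnit B e e' * ρ * (leftUnit B e e')ᴴ := by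
  ext ⟨i, b⟩ ⟨j, b'⟩
  simp only [Matrix.sum_apply, leftUnit_mul_mul, Matrix.kronecker_apply, traceLeft,
    Matrix.of_apply, Matrix.one_apply]
  by_cases h : i = j
  · subst h
    simp [Finset.sum_ite_irrel]
  · have : ∀ e, ¬ (e = i ∧ e = j) := fun e he => h (he.1 ▸ he.2)
    simp [h, this]

/-- An exact form of the pinching inequality: the right side is visibly positive when `ρ` is. The
cross terms sum to `ρ` because the projections sum to `1`. -/
theorem card_smul_sum_leftUnit_sub (ρ : Matrix (E × B) (E × B) ℂ) :
    (2 : ℂ) • ((Fintype.card E : ℂ) • ∑ e, leftUnit B e e * ρ * (leftUnit B e e)ᴴ - ρ)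
      = ∑ e, ∑ f, (leftUnit B e e - leftUnit B f f) * ρ *
          (leftUnit B e e - leftUnit B f f)ᴴ := by
  have h1 : ∀ e f : E, (leftUnit B e e - leftUnit B f f) * ρ *
      (leftUnit B e e - leftUnit B f f)ᴴ = leftUnit B e e * ρ * leftUnit B e e
        + leftUnit B f f * ρ * leftUnit B f f - leftUnit B e e * ρ * leftUnit B f f
        - leftUnit B f f * ρ * leftUnit B e e := by
    intro e f
    rw [Matrix.conjTranspose_sub, leftUnit_isHermitian, leftUnit_isHermitian]
    noncomm_ring
  have h2 : ∑ e, ∑ f, leftUnit B e e * ρ * leftUnit B f f = ρ := by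
    simp only [← Finset.mul_sum, sum_leftUnit, ← Finset.sum_mul, Matrix.mul_one, Matrix.one_mul]
  have h3 : ∑ e, ∑ f, leftUnit B f f * ρ * leftUnit B e e = ρ := by
    rw [Finset.sum_comm, h2]
  simp only [h1, Finset.sum_sub_distrib, Finset.sum_add_distrib, h2, h3, leftUnit_isHermitian,
    Finset.sum_const, Finset.card_univ, ← Finset.smul_sum, ← Nat.cast_smul_eq_nsmul ℂ]
  module

/-- A bipartite state is at most `dim E` times the product of the identity with its reduced
state. -/
theorem card_smul_one_kronecker_traceLeft_sub_posSemidef {ρ : Matrix (E × B) (E × B) ℂ}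
    (hρ : ρ.PosSemidef) :
    ((Fintype.card E : ℂ) • ((1 : Matrix E E ℂ) ⊗ₖ traceLeft ρ) - ρ).PosSemidef := by
  have hd : (0 : ℂ) ≤ (Fintype.card E : ℂ) := by positivity
  have h1 : ((2 : ℂ)⁻¹ • ∑ e, ∑ f, (leftUnit B e e - leftUnit B f f) * ρ *
      (leftUnit B e e - leftUnit B f f)ᴴ).PosSemidef :=
    (posSemidef_sum _ fun e _ => posSemidef_sum _ fun f _ =>
      hρ.mul_mul_conjTranspose_same _).smul (by positivity)
  rw [← card_smul_sum_leftUnit_sub, smul_smul, inv_mul_cancel₀ two_ne_zero, one_smul] at h1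
  -- The off-diagonal terms are positive too; adding them to the pinching turns it into the identity
  -- tensor the reduced state.
  have h2 : ((Fintype.card E : ℂ) • ∑ e : E, ∑ e' ∈ Finset.univ.erase e,
      leftUnit B e e' * ρ * (leftUnit B e e')ᴴ).PosSemidef :=
    (posSemidef_sum _ fun e _ => posSemidef_sum _ fun f _ =>
      hρ.mul_mul_conjTranspose_same _).smul hd
  convert h2.add h1 using 1
  have h3 : ∀ e : E, ∑ e', leftUnit B e e' * ρ * (leftUnit B e e')ᴴ
      = ∑ e' ∈ Finset.univ.erase e, leftUnit B e e' * ρ * (leftUnit B e e')ᴴ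
        + leftUnit B e e * ρ * (leftUnit B e e)ᴴ := fun e =>
    (Finset.sum_erase_add _ _ (Finset.mem_univ e)).symm
  simp only [one_kronecker_traceLeft, h3, Finset.sum_add_distrib, smul_add, add_sub_assoc]

theorem QuantumChannel.applyLeft_posSemidef (Φ : QuantumChannel D E)
    {ρ : Matrix (D × B) (D × B) ℂ} (hρ : ρ.PosSemidef) : (Φ.applyLeft ρ).PosSemidef :=
  posSemidef_sum _ fun _ _ => hρ.mul_mul_conjTranspose_same _

/-- An operation on the first half does not change the reduced state of the second half. -/
theorem QuantumChannel.traceLeft_applyLeft (Φ : QuantumChannel D E)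
    (ρ : Matrix (D × B) (D × B) ℂ) : traceLeft (Φ.applyLeft ρ) = traceLeft ρ := by
  ext b b'
  have hK : ∀ d d' : D, ∑ i, ∑ e, Φ.kraus i e d * star (Φ.kraus i e d')
      = if d = d' then 1 else 0 := by
    intro d d'
    have h := congrFun (congrFun Φ.sum_kraus d') d
    simp only [Matrix.sum_apply, Matrix.mul_apply, Matrix.conjTranspose_apply,
      Matrix.one_apply] at h
    rw [if_congr (eq_comm (a := d)) rfl rfl, ← h]
    exact Finset.sum_congr rfl fun i _ => Finset.sum_congr rfl fun e _ => mul_comm _ _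
  have h1 : ∀ (i : Fin Φ.numKraus) (e : E), ((Φ.kraus i ⊗ₖ (1 : Matrix B B ℂ)) * ρ *
      (Φ.kraus i ⊗ₖ (1 : Matrix B B ℂ)).conjTranspose) (e, b) (e, b')
      = ∑ d', ∑ d, Φ.kraus i e d * star (Φ.kraus i e d') * ρ (d, b) (d', b') := by
    intro i e
    simp only [Matrix.mul_apply, Matrix.conjTranspose_apply, Matrix.kronecker_apply,
      Matrix.one_apply, Fintype.sum_prod_type]
    refine Finset.sum_congr rfl fun d' _ => ?_
    simp only [mul_ite, mul_one, mul_zero, ite_mul, zero_mul, Finset.sum_mul, apply_ite star, star_zero,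
      Finset.sum_ite_eq, Finset.mem_univ, if_true]
    refine Finset.sum_congr rfl fun d _ => by ring
  simp only [traceLeft, Matrix.of_apply, QuantumChannel.applyLeft, Matrix.sum_apply, h1]
  calc ∑ e, ∑ i, ∑ d', ∑ d, Φ.kraus i e d * star (Φ.kraus i e d') * ρ (d, b) (d', b')
      = ∑ d', ∑ d, ∑ i, ∑ e, Φ.kraus i e d * star (Φ.kraus i e d') * ρ (d, b) (d', b') := by
        rw [Finset.sum_comm]
        simp_rw [Finset.sum_comm (s := (Finset.univ : Finset E))]
        rw [Finset.sum_comm]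
        refine Finset.sum_congr rfl fun d' _ => Finset.sum_comm
    _ = ∑ d', ∑ d, (if d = d' then 1 else 0) * ρ (d, b) (d', b') := by
        simp_rw [← Finset.sum_mul, hK]
    _ = ∑ d, ρ (d, b) (d, b') := by simp

end PartialTrace

/-! ### Messages and their common upper bound -/

namespace QCMAProtocol

variable {X Y : Type} (P : QCMAProtocol X Y)

/-- The state on which Bob performs his measurement. -/
noncomputable def message (x : X) (p : Fin P.proofLen → Bool) :
    Matrix (Qubits P.msgLen × Fin P.dimB) (Qubits P.msgLen × Fin P.dimB) ℂ :=
  (P.alice x p).applyLeft P.shared.mat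

theorem message_posSemidef (x : X) (p : Fin P.proofLen → Bool) : (P.message x p).PosSemidef :=
  (P.alice x p).applyLeft_posSemidef P.shared.posSemidef

theorem message_trace (x : X) (p : Fin P.proofLen → Bool) : (P.message x p).trace = 1 := by
  rw [← trace_traceLeft, message, QuantumChannel.traceLeft_applyLeft, trace_traceLeft,
    P.shared.trace_eq_one]

/-- An input-independent matrix that dominates all messages. -/
noncomputable def messageBound :
    Matrix (Qubits P.msgLen × Fin P.dimB) (Qubits P.msgLen × Fin P.dimB) ℂ :=
  (Fintype.card (Qubits P.msgLen) : ℂ) •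
    ((1 : Matrix (Qubits P.msgLen) (Qubits P.msgLen) ℂ) ⊗ₖ traceLeft P.shared.mat)

theorem messageBound_sub_posSemidef (x : X) (p : Fin P.proofLen → Bool) :
    (P.messageBound - P.message x p).PosSemidef := by
  have h := card_smul_one_kronecker_traceLeft_sub_posSemidef (P.message_posSemidef x p)
  rwa [message, QuantumChannel.traceLeft_applyLeft] at h

theorem messageBound_posSemidef (x : X) (p : Fin P.proofLen → Bool) :
    P.messageBound.PosSemidef := by
  simpa using (P.messageBound_sub_posSemidef x p).add (P.message_posSemidef x p)

/-- One factor `2 ^ q` is the scalar, the other is the trace of the identity. -/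
theorem messageBound_trace : P.messageBound.trace = ((4 ^ P.msgLen : ℝ) : ℂ) := by
  rw [messageBound, Matrix.trace_smul, Matrix.trace_kronecker, Matrix.trace_one, trace_traceLeft,
    P.shared.trace_eq_one, mul_one, smul_eq_mul, Fintype.card_fun, Fintype.card_bool,
    Fintype.card_fin]
  push_cast
  rw [← mul_pow]
  norm_num

theorem bob_isEffect (y : Y) : IsEffect (P.bob y).acc :=
  ⟨(P.bob y).acc_posSemidef, (P.bob y).rej_posSemidef⟩

end QCMAProtocol

/-! ### Counting subsets with a large intersection -/

section Counting

theorem four_pow_mul_descFactorial_le {u m : ℕ} (h : 4 * u ≤ m) (j : ℕ) :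
    4 ^ j * u.descFactorial j ≤ m.descFactorial j := by
  induction j with
  | zero => simp
  | succ j ih =>
    rw [Nat.descFactorial_succ, Nat.descFactorial_succ]
    calc 4 ^ (j + 1) * ((u - j) * u.descFactorial j)
        = (4 * (u - j)) * (4 ^ j * u.descFactorial j) := by ring
      _ ≤ (m - j) * m.descFactorial j := Nat.mul_le_mul (by omega) ih

theorem four_pow_mul_choose_le {u m : ℕ} (h : 4 * u ≤ m) (j : ℕ) :
    4 ^ j * u.choose j ≤ m.choose j := by
  have h1 := four_pow_mul_descFactorial_le h j
  rw [Nat.descFactorial_eq_factorial_mul_choose, Nat.descFactorial_eq_factorial_mul_choose] at h1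
  refine Nat.le_of_mul_le_mul_left ?_ (Nat.factorial_pos j)
  linarith [h1, mul_left_comm (4 ^ j) j.factorial (u.choose j)]

variable {α : Type*} [DecidableEq α]

theorem card_filter_subset_powersetCard_le {s J : Finset α} (hJ : J ⊆ s) (k : ℕ) :
    ((s.powersetCard k).filter (J ⊆ ·)).card ≤ (s.card - J.card).choose (k - J.card) := by
  rw [← Finset.card_sdiff_of_subset hJ, ← Finset.card_powersetCard]
  refine Finset.card_le_card_of_injOn (· \ J) ?_ ?_
  · intro I hI
    simp only [Finset.coe_filter, Set.mem_ofPred_eq, Finset.mem_powersetCard] at hI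
    simp only [Finset.mem_coe, Finset.mem_powersetCard]
    exact ⟨Finset.sdiff_subset_sdiff hI.1.1 le_rfl, by
      rw [Finset.card_sdiff_of_subset hI.2, hI.1.2]⟩
  · intro I hI I' hI' h
    simp only [Finset.coe_filter, Set.mem_ofPred_eq] at hI hI'
    rw [← Finset.sdiff_union_of_subset hI.2, ← Finset.sdiff_union_of_subset hI'.2]
    exact congrArg (· ∪ J) h

/-- Few `k`-subsets of `s` have `j` elements in a subset `U` of at most a quarter of the size. -/
theorem card_filter_le_card_inter_mul_le {s U : Finset α} (hU : U ⊆ s)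
    (h4 : 4 * U.card ≤ s.card) {j k : ℕ} (hjk : j ≤ k) :
    ((s.powersetCard k).filter (fun I => j ≤ (I ∩ U).card)).card * 4 ^ j
      ≤ 2 ^ k * s.card.choose k := by
  -- Union bound over the `j`-subsets `J` of `U` that `I` may contain.
  have h1 : (s.powersetCard k).filter (fun I => j ≤ (I ∩ U).card)
      ⊆ (U.powersetCard j).biUnion fun J => (s.powersetCard k).filter (J ⊆ ·) := by
    intro I hI
    obtain ⟨hI1, hI2⟩ := Finset.mem_filter.mp hI
    obtain ⟨J, hJ, hJc⟩ := Finset.exists_subset_card_eq hI2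
    exact Finset.mem_biUnion.mpr ⟨J, Finset.mem_powersetCard.mpr
      ⟨hJ.trans Finset.inter_subset_right, hJc⟩, Finset.mem_filter.mpr
      ⟨hI1, hJ.trans Finset.inter_subset_left⟩⟩
  have h2 : ((s.powersetCard k).filter (fun I => j ≤ (I ∩ U).card)).card
      ≤ U.card.choose j * (s.card - j).choose (k - j) := by
    refine (Finset.card_le_card h1).trans ?_
    rw [← Finset.card_powersetCard]
    refine Finset.card_biUnion_le_card_mul _ _ _ fun J hJ => ?_
    obtain ⟨hJ1, hJ2⟩ := Finset.mem_powersetCard.mp hJ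
    simpa [hJ2] using card_filter_subset_powersetCard_le (hJ1.trans hU) k
  calc _ ≤ U.card.choose j * (s.card - j).choose (k - j) * 4 ^ j := Nat.mul_le_mul_right _ h2
    _ = (4 ^ j * U.card.choose j) * (s.card - j).choose (k - j) := by ring
    _ ≤ s.card.choose j * (s.card - j).choose (k - j) :=
        Nat.mul_le_mul_right _ (four_pow_mul_choose_le h4 j)
    _ = s.card.choose k * k.choose j := (Nat.choose_mul hjk).symm
    _ ≤ s.card.choose k * 2 ^ k := Nat.mul_le_mul_left _ (Nat.choose_le_two_pow k j)
    _ = _ := mul_comm _ _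

end Counting

/-! ### A Gilbert–Varshamov code -/

section Code

/-- The number of positions where two words agree. -/
def agreement {m b : ℕ} (g g' : Fin m → Fin b) : ℕ := (Finset.univ.filter fun j => g j = g' j).card

theorem agreement_comm {m b : ℕ} (g g' : Fin m → Fin b) : agreement g g' = agreement g' g := by
  simp only [agreement, eq_comm]

theorem card_eqOn {m b : ℕ} (g : Fin m → Fin b) (s : Finset (Fin m)) :
    (Finset.univ.filter fun g' : Fin m → Fin b => ∀ j ∈ s, g j = g' j).card
      = b ^ (m - s.card) := by
  have h : (Finset.univ.filter fun g' : Fin m → Fin b => ∀ j ∈ s, g j = g' j)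
      = Fintype.piFinset (fun j => if j ∈ s then {g j} else Finset.univ) := by
    ext g'
    simp only [Finset.mem_filter, Finset.mem_univ, true_and, Fintype.mem_piFinset]
    refine forall_congr' fun j => ?_
    by_cases hj : j ∈ s <;> simp [hj, eq_comm]
  rw [h, Fintype.card_piFinset]
  simp only [apply_ite Finset.card, Finset.card_singleton, Finset.card_univ, Fintype.card_fin]
  rw [Finset.prod_ite, Finset.prod_const_one, one_mul, Finset.prod_const]
  congr 1
  rw [Finset.filter_not, Finset.card_sdiff_of_subset (Finset.filter_subset _ _)]
  simp

theorem card_agreement_le {m : ℕ} (g : Fin m → Fin 256) :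
    (Finset.univ.filter fun g' => m < 4 * agreement g g').card ≤ 128 ^ m := by
  -- Union bound over the agreement set: at most `2 ^ m` sets, each leaving fewer than `3 m / 4`
  -- free letters, hence at most `64 ^ m` words.
  have h1 : (Finset.univ.filter fun g' => m < 4 * agreement g g')
      ⊆ (Finset.univ.filter fun s : Finset (Fin m) => m < 4 * s.card).biUnion
        fun s => Finset.univ.filter fun g' : Fin m → Fin 256 => ∀ j ∈ s, g j = g' j := by
    intro g' hg'
    refine Finset.mem_biUnion.mpr ⟨Finset.univ.filter fun j => g j = g' j, ?_, ?_⟩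
    · exact Finset.mem_filter.mpr ⟨Finset.mem_univ _, (Finset.mem_filter.mp hg').2⟩
    · simp
  calc _ ≤ (Finset.univ.filter fun s : Finset (Fin m) => m < 4 * s.card).card * 64 ^ m := by
        refine (Finset.card_le_card h1).trans (Finset.card_biUnion_le_card_mul _ _ _ fun s hs => ?_)
        have hs := (Finset.mem_filter.mp hs).2
        rw [card_eqOn]
        calc 256 ^ (m - s.card) = 4 ^ (4 * (m - s.card)) := by rw [pow_mul]; norm_num
          _ ≤ 4 ^ (3 * m) := Nat.pow_le_pow_right (by norm_num) (by omega)
          _ = 64 ^ m := by rw [pow_mul]; norm_num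
    _ ≤ 2 ^ m * 64 ^ m := by
        refine Nat.mul_le_mul_right _ ((Finset.card_filter_le _ _).trans ?_)
        simp
    _ = 128 ^ m := by rw [← mul_pow]; norm_num

/-- Gilbert–Varshamov: many words with pairwise agreement at most a quarter. -/
theorem exists_code {m : ℕ} (hm : 0 < m) : ∃ G : Finset (Fin m → Fin 256), 2 ^ m ≤ G.card ∧
    ∀ g ∈ G, ∀ g' ∈ G, g ≠ g' → 4 * agreement g g' ≤ m := by
  classical
  obtain ⟨G, hG⟩ := (Finset.univ.filter fun G : Finset (Fin m → Fin 256) =>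
    ∀ g ∈ G, ∀ g' ∈ G, g ≠ g' → 4 * agreement g g' ≤ m).exists_maximal ⟨∅, by simp⟩
  have hG1 := (Finset.mem_filter.mp hG.prop).2
  refine ⟨G, ?_, hG1⟩
  -- By maximality, a word outside all the balls could be added to `G`.
  have hcover : (Finset.univ : Finset (Fin m → Fin 256))
      ⊆ G.biUnion fun g => Finset.univ.filter fun g' => m < 4 * agreement g g' := by
    intro g' _
    by_contra hg'
    simp only [Finset.mem_biUnion, Finset.mem_filter, Finset.mem_univ, true_and, not_exists,
      not_and, not_lt] at hg'
    have hself : agreement g' g' = m := by simp [agreement]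
    have hnot : g' ∉ G := fun h => by have := hg' g' h; omega
    refine hnot (hG.le_of_ge (y := insert g' G) ?_ (Finset.subset_insert _ _)
      (Finset.mem_insert_self _ _))
    refine Finset.mem_filter.mpr ⟨Finset.mem_univ _, fun a ha b hb hab => ?_⟩
    rcases Finset.mem_insert.mp ha with ha' | ha' <;>
      rcases Finset.mem_insert.mp hb with hb' | hb'
    · exact absurd (ha'.trans hb'.symm) hab
    · rw [agreement_comm, ha']; exact hg' b hb'
    · rw [hb']; exact hg' a ha'
    · exact hG1 a ha' b hb' hab
  have h1 : 256 ^ m ≤ G.card * 128 ^ m := by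
    have := (Finset.card_le_card hcover).trans
      (Finset.card_biUnion_le_card_mul _ _ _ fun g _ => card_agreement_le g)
    simpa using this
  refine Nat.le_of_mul_le_mul_right (c := 128 ^ m) ?_ (by positivity)
  calc 2 ^ m * 128 ^ m = 256 ^ m := by rw [← mul_pow]; norm_num
    _ ≤ _ := h1

/-- The set of ones of a bit string. -/
def ones {n : ℕ} (x : Fin n → Bool) : Finset (Fin n) := Finset.univ.filter fun i => x i = true

/-- Exponentially many bit strings of the same weight with small pairwise intersections. -/
theorem exists_bitstrings {m n : ℕ} (hm : 0 < m) (hmn : 256 * m ≤ n) :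
    ∃ G : Finset (Fin n → Bool), 2 ^ m ≤ G.card ∧ (∀ x ∈ G, (ones x).card = m) ∧
      ∀ x ∈ G, ∀ y ∈ G, x ≠ y → 4 * (ones x ∩ ones y).card ≤ m := by
  classical
  obtain ⟨G, hG1, hG2⟩ := exists_code hm
  -- One block of 256 positions per letter, holding a single one: common ones are exactly
  -- agreements.
  let e : Fin m × Fin 256 → Fin n :=
    fun a => Fin.castLE (by omega : m * 256 ≤ n) (finProdFinEquiv a)
  have he : Function.Injective e := (Fin.castLE_injective _).comp finProdFinEquiv.injective
  let word : (Fin m → Fin 256) → (Fin n → Bool) := fun g i => decide (∃ j, e (j, g j) = i)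
  have hinj : ∀ g : Fin m → Fin 256, Function.Injective fun j => e (j, g j) := fun g j j' h =>
    congrArg Prod.fst (he h)
  have hones : ∀ g, ones (word g) = Finset.univ.image fun j => e (j, g j) := by
    intro g
    ext i
    simp [ones, word]
  have hcard : ∀ g, (ones (word g)).card = m := fun g => by
    rw [hones, Finset.card_image_of_injective _ (hinj g)]
    simp
  have hinter : ∀ g g', (ones (word g) ∩ ones (word g')).card ≤ agreement g g' := by
    intro g g'
    refine le_trans (Finset.card_le_card (t := (Finset.univ.filter fun j => g j = g' j).image
      fun j => e (j, g j)) ?_) Finset.card_image_le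
    intro i hi
    rw [hones, hones] at hi
    simp only [Finset.mem_inter, Finset.mem_image, Finset.mem_univ, true_and] at hi
    obtain ⟨⟨j, rfl⟩, j', hj'⟩ := hi
    have h := he hj'
    obtain ⟨rfl, h2⟩ := Prod.mk.inj h
    exact Finset.mem_image.mpr ⟨j', by simp [h2], rfl⟩
  have hwinj : Set.InjOn word G := by
    intro g hg g' hg' h
    by_contra hne
    have h1 := hinter g g'
    rw [← h, Finset.inter_self, hcard] at h1
    have := hG2 g hg g' hg' hne
    omega
  refine ⟨G.image word, by rwa [Finset.card_image_of_injOn hwinj], ?_, ?_⟩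
  · intro x hx
    obtain ⟨g, _, rfl⟩ := Finset.mem_image.mp hx
    exact hcard g
  · intro x hx y hy hxy
    obtain ⟨g, hg, rfl⟩ := Finset.mem_image.mp hx
    obtain ⟨g', hg', rfl⟩ := Finset.mem_image.mp hy
    have h1 := hinter g g'
    have h2 := hG2 g hg g' hg' (fun h => hxy (by rw [h]))
    omega

end Code

/-! ### Finding a useful test -/

section Step

open Classical in
/-- If for distinct `x`, `x'` almost all members of `F x'` are negative for `x`, then every large
set of candidates has a test that is positive for many and negative for almost all of them. -/
theorem exists_positive_negative {X ι : Type*} [Fintype ι] [Nonempty ι] (F : X → Finset ι)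
    (hF : ∀ x, (F x).Nonempty) (Neg : X → ι → Prop) {β : ℝ} (hβ : 0 < β)
    (h : ∀ x x', x ≠ x' → (((F x').filter fun i => ¬ Neg x i).card : ℝ) ≤ β * (F x').card)
    (S : Finset X) (hS : 1 / β ≤ S.card) :
    ∃ i, (S.card : ℝ) ≤ Fintype.card ι * (S.filter fun x => i ∈ F x).card ∧
      (1 - 2 * β) * S.card ≤ (S.filter fun x => Neg x i).card := by
  have hβS : 1 ≤ β * S.card := by rwa [div_le_iff₀' hβ] at hS
  -- Averaging over `F x'`: the candidates other than `x'` contribute at most `β * S.card`, and `x'`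
  -- itself at most `1 ≤ β * S.card`.
  have hex : ∀ x', ∃ i ∈ F x', ((S.filter fun x => ¬ Neg x i).card : ℝ) ≤ 2 * β * S.card := by
    intro x'
    refine Finset.exists_le_of_sum_le (hF x') (f := fun i => ((S.filter fun x => ¬ Neg x i).card : ℝ))
      (g := fun _ => 2 * β * S.card) ?_
    have hcomm : ∑ i ∈ F x', ((S.filter fun x => ¬ Neg x i).card : ℝ)
        = ∑ x ∈ S, (((F x').filter fun i => ¬ Neg x i).card : ℝ) := by
      simp only [Finset.card_filter, Nat.cast_sum]
      exact Finset.sum_comm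
    rw [hcomm]
    calc ∑ x ∈ S, (((F x').filter fun i => ¬ Neg x i).card : ℝ)
        ≤ ∑ x ∈ S, (β * (F x').card + if x = x' then ((F x').card : ℝ) else 0) := by
          refine Finset.sum_le_sum fun x _ => ?_
          by_cases hx : x = x'
          · have h1 : (((F x').filter fun i => ¬ Neg x i).card : ℝ) ≤ (F x').card := by
              exact_mod_cast Finset.card_filter_le _ _
            have h2 : 0 ≤ β * (F x').card := by positivity
            rw [if_pos hx]
            linarith
          · rw [if_neg hx, add_zero]
            exact h x x' hx
      _ ≤ S.card * (β * (F x').card) + (F x').card := by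
          rw [Finset.sum_add_distrib, Finset.sum_const, nsmul_eq_mul, Finset.sum_ite_eq']
          gcongr
          split_ifs
          · exact le_rfl
          · positivity
      _ ≤ ∑ i ∈ F x', 2 * β * S.card := by
          rw [Finset.sum_const, nsmul_eq_mul]
          have : (0 : ℝ) ≤ (F x').card := by positivity
          nlinarith
  choose f hf1 hf2 using hex
  have hS0 : (0 : ℝ) < S.card := lt_of_lt_of_le (by positivity) hS
  -- Pigeonhole: some test is the chosen one for many candidates, hence positive for all of these.
  have hpig : ∃ i ∈ (Finset.univ : Finset ι), (S.card : ℝ) / Fintype.card ι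
      ≤ (S.filter fun x => f x = i).card := by
    refine Finset.exists_le_of_sum_le Finset.univ_nonempty ?_
    have h1 : S.card = ∑ i, (S.filter fun x => f x = i).card :=
      Finset.card_eq_sum_card_fiberwise fun _ _ => Finset.mem_coe.mpr (Finset.mem_univ _)
    rw [Finset.sum_const, nsmul_eq_mul, Finset.card_univ, ← Nat.cast_sum, ← h1,
      mul_div_cancel₀ _ (by positivity)]
  obtain ⟨i, _, hi⟩ := hpig
  have hι : (0 : ℝ) < Fintype.card ι := by positivity
  have hfib : (0 : ℝ) < (S.filter fun x => f x = i).card := lt_of_lt_of_le (by positivity) hi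
  obtain ⟨x0, hx0⟩ := Finset.card_pos.mp (by exact_mod_cast hfib)
  have hx0i : f x0 = i := (Finset.mem_filter.mp hx0).2
  refine ⟨i, ?_, ?_⟩
  · rw [div_le_iff₀' hι] at hi
    refine hi.trans (mul_le_mul_of_nonneg_left ?_ hι.le)
    have : (S.filter fun x => f x = i) ⊆ S.filter fun x => i ∈ F x := fun x hx => by
      obtain ⟨h1, h2⟩ := Finset.mem_filter.mp hx
      exact Finset.mem_filter.mpr ⟨h1, h2 ▸ hf1 x⟩
    exact_mod_cast Finset.card_le_card this
  · have h1 := hf2 x0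
    rw [hx0i] at h1
    have h2 : ((S.filter fun x => Neg x i).card : ℝ) + (S.filter fun x => ¬ Neg x i).card
        = S.card := by
      exact_mod_cast Finset.card_filter_add_card_filter_not (s := S) (fun x => Neg x i)
    linarith

end Step

/-! ### Index sets, popular proofs and `0`-inputs of MajIx -/

section MajIx

variable {n : ℕ}

theorem inter_ones_eq_filter (x : Fin n → Bool) (I : Finset (Fin n)) :
    I ∩ ones x = I.filter fun i => x i = true := by
  ext i
  simp [ones]

theorem majIx_eq_true {x : Fin n → Bool} {I : IndexSet n} (h : I.1 ⊆ ones x) :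
    MajIx n x I = some true := by
  have h1 : I.1.filter (fun i => x i = true) = I.1 := by
    rw [← inter_ones_eq_filter, Finset.inter_eq_left.mpr h]
  rw [MajIx, if_pos (by rw [h1, I.2])]

theorem majIx_eq_false {x : Fin n → Bool} {I : IndexSet n} (hk : 0 < Nat.sqrt n)
    (h : (I.1 ∩ ones x).card < 9 * Nat.sqrt n / 10) : MajIx n x I = some false := by
  rw [inter_ones_eq_filter] at h
  have h1 : (I.1.filter (fun i => x i = true)).card ≠ Nat.sqrt n := by omega
  have h2 : 10 * (I.1.filter (fun i => x i = true)).card ≤ 9 * Nat.sqrt n := by omega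
  have h3 : (10 : ℝ) * (I.1.filter (fun i => x i = true)).card ≤ 9 * Nat.sqrt n := by
    exact_mod_cast h2
  rw [MajIx, if_neg h1, if_pos (by linarith)]

theorem card_filter_indexSet (p : Finset (Fin n) → Prop) [DecidablePred p] :
    (Finset.univ.filter fun I : IndexSet n => p I.1).card
      = ((Finset.univ.powersetCard (Nat.sqrt n)).filter p).card := by
  rw [← Finset.card_image_of_injective _ Subtype.val_injective]
  congr 1
  ext I
  simp only [Finset.mem_image, Finset.mem_filter, Finset.mem_univ, true_and,
    Finset.mem_powersetCard, Finset.subset_univ]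
  exact ⟨fun ⟨J, hJ, h⟩ => h ▸ ⟨J.2, hJ⟩, fun h => ⟨⟨I, h.1⟩, h.2, rfl⟩⟩

theorem card_filter_indexSet_subset (s : Finset (Fin n)) :
    (Finset.univ.filter fun I : IndexSet n => I.1 ⊆ s).card = s.card.choose (Nat.sqrt n) := by
  rw [card_filter_indexSet (· ⊆ s), ← Finset.card_powersetCard]
  congr 1
  ext I
  simp [Finset.mem_powersetCard, and_comm]

theorem card_indexSet_le {l : ℕ} (hn : n ≤ 2 ^ l) :
    Fintype.card (IndexSet n) ≤ 2 ^ (l * Nat.sqrt n) := by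
  have h := card_filter_indexSet_subset (Finset.univ : Finset (Fin n))
  simp only [Finset.subset_univ, Finset.filter_true, Finset.card_univ, Fintype.card_fin] at h
  rw [h, pow_mul]
  exact (Nat.choose_le_pow n _).trans (Nat.pow_le_pow_left hn _)

/-- A most popular proof is accepted for a `2^(-proofLen)` fraction of the index sets inside the
ones of `x`. -/
theorem exists_popular_proof {P : QCMAProtocol (Fin n → Bool) (IndexSet n)}
    (hP : P.Computes (MajIx n)) (x : Fin n → Bool) :
    ∃ p, (ones x).card.choose (Nat.sqrt n) ≤ 2 ^ P.proofLen *
      (Finset.univ.filter fun I : IndexSet n =>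
        I.1 ⊆ ones x ∧ 2 / 3 ≤ P.acceptProb x I p).card := by
  classical
  have hex : ∀ I : IndexSet n, ∃ p, I.1 ⊆ ones x → 2 / 3 ≤ P.acceptProb x I p := by
    intro I
    by_cases h : I.1 ⊆ ones x
    · obtain ⟨p, hp⟩ := hP.1 x I (majIx_eq_true h)
      exact ⟨p, fun _ => hp⟩
    · exact ⟨fun _ => false, fun h' => absurd h' h⟩
  choose pr hpr using hex
  by_contra! hcon
  have h1 := Finset.card_eq_sum_card_fiberwise (f := pr)
    (s := Finset.univ.filter fun I : IndexSet n => I.1 ⊆ ones x) (t := Finset.univ)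
    (fun _ _ => Finset.mem_coe.mpr (Finset.mem_univ _))
  rw [card_filter_indexSet_subset] at h1
  have h2 : ∀ p, ((Finset.univ.filter fun I : IndexSet n => I.1 ⊆ ones x).filter
      fun I => pr I = p).card ≤ (Finset.univ.filter fun I : IndexSet n =>
        I.1 ⊆ ones x ∧ 2 / 3 ≤ P.acceptProb x I p).card := by
    intro p
    refine Finset.card_le_card fun I hI => ?_
    simp only [Finset.mem_filter, Finset.mem_univ, true_and] at hI ⊢
    exact ⟨hI.1, hI.2 ▸ hpr I hI.1⟩
  have h3 : 2 ^ P.proofLen * (ones x).card.choose (Nat.sqrt n)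
      < 2 ^ P.proofLen * (ones x).card.choose (Nat.sqrt n) := by
    calc 2 ^ P.proofLen * (ones x).card.choose (Nat.sqrt n)
        = ∑ p : Fin P.proofLen → Bool, 2 ^ P.proofLen * ((Finset.univ.filter
          fun I : IndexSet n => I.1 ⊆ ones x).filter fun I => pr I = p).card := by
          rw [← Finset.mul_sum, ← h1]
      _ < ∑ _p : Fin P.proofLen → Bool, (ones x).card.choose (Nat.sqrt n) :=
          Finset.sum_lt_sum_of_nonempty Finset.univ_nonempty fun p _ =>
            (Nat.mul_le_mul_left _ (h2 p)).trans_lt (hcon p)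
      _ = _ := by simp
  exact lt_irrefl _ h3

/-- A set inside `ones x'` that is not a `0`-input for `x` has at least `⌊9k/10⌋` elements, `k =
Nat.sqrt n`, in the small overlap with `ones x`. -/
theorem card_not_false_mul_le {x x' : Fin n → Bool} (hk : 0 < Nat.sqrt n)
    (h4 : 4 * (ones x' ∩ ones x).card ≤ (ones x').card)
    {F : Finset (IndexSet n)} (hF : ∀ I ∈ F, I.1 ⊆ ones x') :
    (F.filter fun I => ¬ MajIx n x I = some false).card * 4 ^ (9 * Nat.sqrt n / 10)
      ≤ 2 ^ Nat.sqrt n * (ones x').card.choose (Nat.sqrt n) := by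
  refine le_trans (Nat.mul_le_mul_right _ ?_) (card_filter_le_card_inter_mul_le
    (Finset.inter_subset_left (s₂ := ones x)) h4 (k := Nat.sqrt n) (by omega))
  refine Finset.card_le_card_of_injOn Subtype.val ?_ Subtype.val_injective.injOn
  intro I hI
  obtain ⟨hI1, hI2⟩ := Finset.mem_filter.mp (Finset.mem_coe.mp hI)
  refine Finset.mem_coe.mpr (Finset.mem_filter.mpr
    ⟨Finset.mem_powersetCard.mpr ⟨hF I hI1, I.2⟩, ?_⟩)
  rw [← Finset.inter_assoc, Finset.inter_eq_left.mpr (hF I hI1)]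
  by_contra hlt
  exact hI2 (majIx_eq_false hk (not_le.mp hlt))

end MajIx

/-! ### Numerical bounds and assembly of the argument -/

section Bounds

theorem one_sub_inv_pow_le (L : ℕ) (hL : 0 < L) (s : ℕ) :
    (1 - 1 / (L : ℝ)) ^ (L * s) ≤ (1 / 2) ^ s := by
  have h1 : (1 : ℝ) ≤ L := by exact_mod_cast hL
  have h2 : 0 ≤ 1 - 1 / (L : ℝ) := by
    have : 1 / (L : ℝ) ≤ 1 := by rw [div_le_one (by linarith)]; exact h1
    linarith
  have h3 : (1 - 1 / (L : ℝ)) ^ L ≤ 1 / 2 := by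
    refine (Real.one_sub_div_pow_le_exp_neg h1).trans ?_
    have := Real.exp_neg_one_lt_d9
    linarith
  rw [pow_mul]
  exact pow_le_pow_left₀ (by positivity) h3 s

theorem sqrt_eight_ninths_pow_le (l : ℕ) :
    √((8 / 9 : ℝ) ^ (24 * (l + 1))) ≤ 1 / (4 * 4 ^ l) := by
  rw [Real.sqrt_le_left (by positivity)]
  calc (8 / 9 : ℝ) ^ (24 * (l + 1)) = ((8 / 9) ^ 24) ^ (l + 1) := pow_mul _ _ _
    _ ≤ (1 / 16) ^ (l + 1) := by
        refine pow_le_pow_left₀ (by positivity) ?_ _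
        norm_num
    _ = (1 / (4 * 4 ^ l)) ^ 2 := by
        rw [← pow_succ', div_pow, div_pow, one_pow, one_pow, ← pow_mul, mul_comm (l + 1), pow_mul]
        norm_num

end Bounds

/-- The lower bound on the message length in terms of explicit parameters. -/
theorem mul_le_of_computes {n m l T : ℕ} {P : QCMAProtocol (Fin n → Bool) (IndexSet n)}
    (hP : P.Computes (MajIx n)) (hk : 0 < Nat.sqrt n) (hkm : Nat.sqrt n ≤ m)
    (hmn : 256 * m ≤ n) (hn : n ≤ 2 ^ l) (hl : 0 < l)
    (ha : Nat.sqrt n + P.proofLen + 3 + 2 * l ≤ 2 * (9 * Nat.sqrt n / 10))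
    (hm : 4 + 2 * l + l * Nat.sqrt n * T ≤ m) (hT : l * T ≤ 2 ^ l) :
    l * T ≤ 2 + 96 * P.msgLen * (l + 1) := by
  classical
  obtain ⟨G, hG1, hG2, hG3⟩ := exists_bitstrings (hk.trans_le hkm) hmn
  choose pr hpr using exists_popular_proof hP
  -- All positive tests of `x` use the one proof `pr x`, so a single message state must pass them.
  let F : G → Finset (IndexSet n) := fun x => Finset.univ.filter fun I : IndexSet n =>
    I.1 ⊆ ones x.1 ∧ 2 / 3 ≤ P.acceptProb x.1 I (pr x.1)
  have hFcard : ∀ x : G, m.choose (Nat.sqrt n) ≤ 2 ^ P.proofLen * (F x).card := fun x => by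
    have := hpr x.1
    rwa [hG2 x.1 x.2] at this
  have hFne : ∀ x : G, (F x).Nonempty := fun x => by
    have h1 := hFcard x
    have h2 := Nat.choose_pos hkm
    rw [← Finset.card_pos]
    by_contra h0
    rw [Nat.eq_zero_of_not_pos h0] at h1
    omega
  have hFsub : ∀ x : G, ∀ I ∈ F x, I.1 ⊆ ones x.1 := fun x I hI => (Finset.mem_filter.mp hI).2.1
  have hG0 : 0 < G.card := lt_of_lt_of_le (by positivity) hG1
  obtain ⟨x0, hx0⟩ := Finset.card_pos.mp hG0
  have : Nonempty (IndexSet n) := ⟨(hFne ⟨x0, hx0⟩).choose⟩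
  -- At most `4 ^ l` rejections occur, each losing a fraction `2 * β`: a quarter of the candidates
  -- in all. `ha` pays for the `3 + 2 * l` bits of `1 / β`.
  set β : ℝ := 1 / (8 * 4 ^ l) with hβdef
  have hβ : 0 < β := by positivity
  have hβ8 : β ≤ 1 / 8 := by
    rw [hβdef]
    have : (1 : ℝ) ≤ 4 ^ l := one_le_pow₀ (by norm_num)
    exact one_div_le_one_div_of_le (by norm_num) (by linarith)
  let Neg : G → IndexSet n → Prop := fun x I => MajIx n x.1 I = some false
  have hbad : ∀ x x' : G, x ≠ x' →
      (((F x').filter fun I => ¬ Neg x I).card : ℝ) ≤ β * (F x').card := by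
    intro x x' hne
    have h4 := hG3 x'.1 x'.2 x.1 x.2 fun h => hne (Subtype.ext h.symm)
    have h5 := card_not_false_mul_le (x := x.1) hk (by rw [hG2 x'.1 x'.2]; exact h4) (hFsub x')
    rw [hG2 x'.1 x'.2] at h5
    set c := ((F x').filter fun I => ¬ MajIx n x.1 I = some false).card with hc
    have h6 : c * 2 ^ (3 + 2 * l) ≤ (F x').card := by
      refine Nat.le_of_mul_le_mul_left (c := 2 ^ (Nat.sqrt n + P.proofLen)) ?_ (by positivity)
      calc 2 ^ (Nat.sqrt n + P.proofLen) * (c * 2 ^ (3 + 2 * l))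
          = c * 2 ^ (Nat.sqrt n + P.proofLen + 3 + 2 * l) := by ring
        _ ≤ c * 2 ^ (2 * (9 * Nat.sqrt n / 10)) :=
            Nat.mul_le_mul_left _ (Nat.pow_le_pow_right (by norm_num) ha)
        _ = c * 4 ^ (9 * Nat.sqrt n / 10) := by rw [pow_mul]; norm_num
        _ ≤ 2 ^ Nat.sqrt n * (2 ^ P.proofLen * (F x').card) :=
            h5.trans (Nat.mul_le_mul_left _ (hFcard x'))
        _ = _ := by ring
    have h7 : (c : ℝ) * (8 * 4 ^ l) ≤ (F x').card := by
      have h8 : ((c * 2 ^ (3 + 2 * l) : ℕ) : ℝ) ≤ (F x').card := by exact_mod_cast h6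
      rw [pow_add, pow_mul] at h8
      push_cast at h8
      exact h8
    rw [hβdef, one_div, ← div_eq_inv_mul, le_div_iff₀ (by positivity)]
    exact h7
  -- `(8 / 9) ^ 24 ≤ 1 / 16`, so the error has square root at most `1 / (4 * 4 ^ l)`, small enough
  -- for `2 * 4 ^ l` gentle tests.
  set w : ℕ := 24 * (l + 1) with hw
  let A : IndexSet n → Matrix _ _ ℂ := fun I => majority w (P.bob I).acc
  have hA : ∀ I, IsEffect (A I) := fun I => (P.bob_isEffect I).majority w
  let σ := piKron (fun _ : Fin (2 * w) => P.messageBound)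
  have hσ : σ.PosSemidef := piKron_posSemidef fun _ => P.messageBound_posSemidef x0 (pr x0)
  have hσtr : weight σ 1 = 4 ^ (P.msgLen * (2 * w)) := by
    rw [weight_one, trace_piKron, Finset.prod_const, Finset.card_univ, Fintype.card_fin,
      P.messageBound_trace, ← Complex.ofReal_pow, Complex.ofReal_re, ← pow_mul]
  have hL : (1 : ℝ) ≤ 2 ^ l := one_le_pow₀ (by norm_num)
  have hsteps : 2 ^ l * (l * T) ≤ 4 ^ l := by
    calc 2 ^ l * (l * T) ≤ 2 ^ l * 2 ^ l := Nat.mul_le_mul_left _ hT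
      _ = 4 ^ l := by rw [← mul_pow]; norm_num
  have hstepsR : (2 : ℝ) ^ l * (l * T) ≤ 4 ^ l := by exact_mod_cast hsteps
  obtain ⟨x, _, Bs, hlen, hBs, hR⟩ := exists_tests A hA hσ (fun x I => I ∈ F x) Neg
    (M := 1 / β) (N := 2 ^ (l * Nat.sqrt n)) (γ := 1 - 2 * β) (L := 2 ^ l)
    (R := 4 ^ (P.msgLen * (2 * w)) / (2 ^ l) ^ T)
    (by positivity) (one_le_pow₀ (by norm_num)) (by linarith) (by linarith) hL
    (by
      intro S hS
      obtain ⟨I, h1, h2⟩ := exists_positive_negative F hFne Neg hβ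
        (fun x x' hne => by convert hbad x x' hne) S hS
      have hι : (Fintype.card (IndexSet n) : ℝ) ≤ 2 ^ (l * Nat.sqrt n) := by
        exact_mod_cast card_indexSet_le hn
      refine ⟨I, h1.trans ?_, h2⟩
      gcongr)
    -- `T` acceptances gain `2 ^ (l * T)`; so do `2 ^ l * (l * T)` rejections, since `2 ^ l` of them
    -- at least halve the weight.
    T (2 ^ l * (l * T)) Finset.univ 1
    (by
      have h1 : (1 : ℝ) / 2 ≤ (1 - 2 * β) ^ (2 ^ l * (l * T)) := by
        have h := one_add_mul_le_pow (a := -(2 * β)) (by linarith) (2 ^ l * (l * T))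
        have h' : ((2 ^ l * (l * T) : ℕ) : ℝ) * (2 * β) ≤ 1 / 2 := by
          push_cast
          calc (2 : ℝ) ^ l * (l * T) * (2 * β) ≤ 4 ^ l * (2 * β) := by gcongr
            _ = 1 / 4 := by rw [hβdef]; field_simp; norm_num
            _ ≤ 1 / 2 := by norm_num
        rw [← sub_eq_add_neg] at h
        linarith
      have h2 : (2 : ℝ) ^ (4 + 2 * l + l * Nat.sqrt n * T) ≤ (Finset.univ : Finset G).card := by
        rw [Finset.card_univ, Fintype.card_coe]
        calc (2 : ℝ) ^ (4 + 2 * l + l * Nat.sqrt n * T) ≤ 2 ^ m :=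
              pow_le_pow_right₀ (by norm_num) hm
          _ ≤ G.card := by exact_mod_cast hG1
      calc 1 / β * (2 ^ (l * Nat.sqrt n)) ^ T
          = 1 / 2 * 2 ^ (4 + 2 * l + l * Nat.sqrt n * T) := by
            rw [hβdef, one_div_one_div, ← pow_mul, pow_add, pow_add, pow_mul 2 2 l]
            norm_num
            ring
        _ ≤ _ := mul_le_mul h1 h2 (by positivity) (by positivity))
    (by rw [hσtr])
    (by
      rw [hσtr, div_eq_mul_inv]
      refine mul_le_mul_of_nonneg_left ?_ (by positivity)
      have h := one_sub_inv_pow_le (2 ^ l) (by positivity) (l * T)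
      push_cast at h
      refine h.trans (le_of_eq ?_)
      rw [one_div, inv_pow, pow_mul])
  have hρ := P.message_posSemidef x.1 (pr x.1)
  have hρtr := P.message_trace x.1 (pr x.1)
  have hgood : ∀ B ∈ Bs, IsEffect B ∧ ((1 - B) * piKron (fun _ : Fin (2 * w) =>
      P.message x.1 (pr x.1))).trace.re ≤ (8 / 9) ^ w := by
    intro B hB
    obtain ⟨I, ⟨rfl, hI⟩ | ⟨rfl, hI⟩⟩ := hBs B hB
    · exact ⟨hA I, one_sub_majority_le (P.bob_isEffect I) hρ hρtr w
        (Finset.mem_filter.mp hI).2.2⟩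
    · refine ⟨(hA I).compl, ?_⟩
      rw [sub_sub_cancel]
      exact majority_le (P.bob_isEffect I) hρ hρtr w (hP.2 x.1 I hI (pr x.1))
  have hquarter := le_weight_prod (piKron_posSemidef fun _ : Fin (2 * w) => hρ)
    (by rw [trace_piKron]; simp [hρtr]) Bs (fun B hB => (hgood B hB).1)
    (fun B hB => (hgood B hB).2)
    (by
      have h1 : (Bs.length : ℝ) ≤ 2 * 4 ^ l := by
        have hTl : T ≤ l * T := Nat.le_mul_of_pos_left T hl
        have h2l : 2 ^ l ≤ 4 ^ l := Nat.pow_le_pow_left (by norm_num) l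
        have : Bs.length ≤ 2 * 4 ^ l := by omega
        exact_mod_cast this
      calc (Bs.length : ℝ) * √((8 / 9) ^ w) ≤ 2 * 4 ^ l * (1 / (4 * 4 ^ l)) :=
            mul_le_mul h1 (sqrt_eight_ninths_pow_le l) (by positivity) (by positivity)
        _ = 1 / 2 := by field_simp; norm_num)
  -- Domination compares the `1 / 4` kept by the message with the weight left of `σ`.
  have hmono := weight_mono (piKron_const_sub_posSemidef (r := 2 * w) hρ
    (P.messageBound_sub_posSemidef x.1 (pr x.1))) Bs.prod
  rw [Matrix.mul_one] at hR
  have hfin : (1 : ℝ) / 4 ≤ 4 ^ (P.msgLen * (2 * w)) / (2 ^ l) ^ T :=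
    hquarter.trans (hmono.trans hR)
  rw [le_div_iff₀ (by positivity), ← pow_mul] at hfin
  have hfin2 : (2 : ℝ) ^ (l * T) ≤ 2 ^ (2 + 2 * (P.msgLen * (2 * w))) := by
    rw [pow_add, pow_mul 2 2]
    norm_num at hfin ⊢
    linarith
  have hfin3 := (pow_le_pow_iff_right₀ (by norm_num : (1 : ℝ) < 2)).mp hfin2
  calc l * T ≤ 2 + 2 * (P.msgLen * (2 * w)) := hfin3
    _ = 2 + 96 * P.msgLen * (l + 1) := by rw [hw]; ring

/-! ### Choice of parameters and asymptotics -/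

theorem sqrt_le_mul_cost {n : ℕ} {P : QCMAProtocol (Fin n → Bool) (IndexSet n)}
    (hP : P.Computes (MajIx n)) (hn0 : 0 < n) (hn : 6144 * n.size ≤ Nat.sqrt n) :
    Nat.sqrt n ≤ 393216 * n.size * P.cost := by
  have hl : 0 < n.size := Nat.size_pos.mpr hn0
  set l := n.size
  set k := Nat.sqrt n with hkdef
  have hkn : k * k ≤ n := Nat.sqrt_le n
  have hnl : n < 2 ^ l := Nat.lt_size_self n
  -- A long proof already gives the bound; a short one leaves room in `2 ^ (k + a) ≪ 4 ^ (0.9 k)`,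
  -- where `a` is the proof length.
  by_cases ha : k / 4 < P.proofLen
  · have h1 : k ≤ 4 * P.cost := by
      have : P.proofLen ≤ P.cost := Nat.le_add_right _ _
      omega
    exact h1.trans (Nat.mul_le_mul_right _ (by omega))
  · have hk1024 : 1024 * k ≤ n := (Nat.mul_le_mul_right k (by omega)).trans hkn
    have hTk : l * (k / (1024 * l)) ≤ k / 1024 := by
      rw [Nat.mul_comm 1024, ← Nat.div_div_eq_div_mul, Nat.div_right_comm]
      exact Nat.mul_div_le _ _
    have hTkk : l * k * (k / (1024 * l)) ≤ n / 1024 := by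
      rw [Nat.le_div_iff_mul_le (by norm_num)]
      calc l * k * (k / (1024 * l)) * 1024 = k * (l * (k / (1024 * l)) * 1024) := by ring
        _ ≤ k * (k / 1024 * 1024) := by gcongr
        _ ≤ k * k := Nat.mul_le_mul_left _ (Nat.div_mul_le_self _ _)
        _ ≤ n := hkn
    -- `T` acceptances cost `l * k * T ≤ n / 1024` bits of candidates, within the `n / 256` bits of
    -- the code.
    have hmain := mul_le_of_computes (m := n / 256) (T := k / (1024 * l)) hP (by omega)
      (by omega) (by omega) hnl.le hl (by omega) (by rw [← hkdef]; omega)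
      (by
        have : k ≤ n := Nat.sqrt_le_self n
        omega)
    have hT : k / (1024 * l) ≤ 2 + 192 * P.msgLen := by
      refine Nat.le_of_mul_le_mul_left (c := l) ?_ hl
      nlinarith
    have hk : k < 1024 * l * (k / (1024 * l) + 1) := Nat.lt_mul_div_succ k (by omega)
    have hk2 : k < 1024 * l * (3 + 192 * P.msgLen) :=
      hk.trans_le (Nat.mul_le_mul_left _ (by omega))
    have hcost : l * P.msgLen ≤ l * P.cost := Nat.mul_le_mul_left _ (Nat.le_add_left _ _)
    -- `3072 * l ≤ k / 2` absorbs the additive term, doubling `1024 * 192` to `393216`.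
    nlinarith

open Filter Asymptotics in
theorem eventually_log_le_sqrt :
    ∀ᶠ n : ℕ in atTop, 36864 * Real.log n ≤ Real.sqrt n := by
  have h := (isLittleO_log_rpow_atTop (r := 1 / 2) (by norm_num)).bound
    (c := 1 / 36864) (by norm_num)
  filter_upwards [tendsto_natCast_atTop_atTop.eventually h, eventually_ge_atTop 1] with n hn hn1
  have h1 : 0 ≤ Real.log n := Real.log_natCast_nonneg n
  rw [← Real.sqrt_eq_rpow, Real.norm_of_nonneg h1, Real.norm_of_nonneg (Real.sqrt_nonneg _)] at hn
  linarith

theorem size_le_three_mul_log {n : ℕ} (hn : 3 ≤ n) : (n.size : ℝ) ≤ 3 * Real.log n := by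
  have hl : 0 < n.size := Nat.size_pos.mpr (by omega)
  have h1 : 2 ^ (n.size - 1) ≤ n := Nat.lt_size.mp (by omega)
  have h2 : ((n.size - 1 : ℕ) : ℝ) * Real.log 2 ≤ Real.log n := by
    rw [← Real.log_pow]
    exact Real.log_le_log (by positivity) (by exact_mod_cast h1)
  rw [Nat.cast_sub hl, Nat.cast_one] at h2
  have h3 : 1 ≤ Real.log n := by
    rw [Real.le_log_iff_exp_le (by positivity)]
    have h4 : (3 : ℝ) ≤ n := by exact_mod_cast hn
    have := Real.exp_one_lt_d9
    linarith
  have h5 := Real.log_two_gt_d9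
  nlinarith

theorem sqrt_le_two_mul_natSqrt {n : ℕ} (hn : 0 < n) : Real.sqrt n ≤ 2 * (Nat.sqrt n : ℝ) := by
  have h1 : (1 : ℝ) ≤ Nat.sqrt n := by exact_mod_cast Nat.sqrt_pos.mpr hn
  have h2 := Real.real_sqrt_le_nat_sqrt_succ (a := n)
  linarith

end QComm

theorem mainTheorem2 :
    ∃ C : ℝ, 0 < C ∧ ∃ N : ℕ, ∀ n : ℕ, N ≤ n →
      ENNReal.ofReal (C * (Real.sqrt n / Real.log n)) ≤
        ((QComm.qcmaComplexity (QComm.MajIx n) : ℕ∞) : ENNReal) := by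
  obtain ⟨N, hN⟩ := Filter.eventually_atTop.mp QComm.eventually_log_le_sqrt
  -- `2359296 = 393216 * 3 * 2`: the `3` from `n.size ≤ 3 * log n`, the `2` from rounding the square
  -- root.
  refine ⟨1 / 2359296, by norm_num, max N 3, fun n hn => ?_⟩
  have hn3 : 3 ≤ n := le_of_max_le_right hn
  have hlog := hN n (le_of_max_le_left hn)
  have hsize := QComm.size_le_three_mul_log hn3
  have hsqrt := QComm.sqrt_le_two_mul_natSqrt (n := n) (by omega)
  have hlarge : 6144 * n.size ≤ Nat.sqrt n := by
    have : (6144 * n.size : ℝ) ≤ Nat.sqrt n := by linarith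
    exact_mod_cast this
  have hlog0 : 0 < Real.log n := Real.log_pos (by exact_mod_cast (by omega : 1 < n))
  set r : ℝ := 1 / 2359296 * (Real.sqrt n / Real.log n) with hr
  have hcost : ((⌈r⌉₊ : ℕ) : ℕ∞) ≤ QComm.qcmaComplexity (QComm.MajIx n) := by
    refine le_iInf₂ fun P hP => ?_
    have h1 := QComm.sqrt_le_mul_cost hP (by omega) hlarge
    have h2 : (Nat.sqrt n : ℝ) ≤ 393216 * n.size * P.cost := by exact_mod_cast h1
    have h3 : (393216 * n.size * P.cost : ℝ) ≤ 393216 * (3 * Real.log n) * P.cost := by gcongr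
    have h4 : r ≤ P.cost := by
      rw [hr, ← mul_div_assoc, div_le_iff₀ hlog0]
      linarith
    exact_mod_cast Nat.ceil_le.mpr h4
  calc ENNReal.ofReal r ≤ ((⌈r⌉₊ : ℕ) : ENNReal) := by
        rw [← ENNReal.ofReal_natCast]
        exact ENNReal.ofReal_le_ofReal (Nat.le_ceil r)
    _ = (((⌈r⌉₊ : ℕ) : ℕ∞) : ENNReal) := by simp
    _ ≤ _ := ENat.toENNReal_le.mpr hcost
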